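/- For a real number $y$ let $\|y\|$ denote the distance from $y$ to the nearest integer. For every $\varepsilon>0$ there exists a constant $c_\varepsilon>0$, depending only on $\varepsilon$, with the following property. Let $(q_n)_{n\geq 1}$ be a sequence of real numbers satisfying, for all sufficiently large $n$, the gap condition \[ \frac{q_{n+1}}{q_n} > 1+\frac{1}{n^{1-\varepsilon}}. \] Then for every $0<c\leq c_\varepsilon$ and for Lebesgue-almost every $x\in[0,1)$ there exists $\delta_0\in[0,1)$ such that \[ \|q_n x-\delta_0\| < \frac{c}{n} \] holds for at most finitely many $n\geq 1$. -/

import Mathlib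

/-- The distance from a real number to the nearest integer. -/
noncomputable def distInt (y : ℝ) : ℝ := |y - round y|

/-- `distInt y` is at most the distance from `y` to any integer. -/
theorem distInt_le (y : ℝ) (m : ℤ) : distInt y ≤ |y - m| := round_le y m

/-!
Why the theorem holds. For fixed `x`, follow the set of `δ ∈ [0, 1]` that have not yet been covered
by any of the arcs `‖q_n x - δ‖ < c/n`. If the points `q_n x` were independent and uniform, the
measure of this set would decay like `n ^ (-2c)`, so for small `c` it stays far above the length
`c/n` of a single arc and never vanishes. Compactness then gives a `δ` that is never covered.

The gap condition supplies enough independence. Cut the indices into windows `[j^p, (j+1)^p)` with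
`2/p ≤ ε`. Across one window `|q_n|` grows by more than any fixed power of `j`
(`eventually_window_growth`), so there is a dyadic grid of mesh `1/N_j` that is finer than
`c / (n |q_n|)` for `n` in window `j`, and yet coarser than `1/|q_n|` for `n` in window `j + 2`.
Replacing `x` by its grid point `x_j` costs a factor `2` in the arc lengths and makes the set
`V_j(x)` of survivors of the windows before `j` constant on the cells of the grid `j - 1`. For `n`
in window `j` and a cell of the grid `j - 2`, the points `q_n x` run at least once around the
circle, so an arc meets `V_{j-1}` in the proportion expected for a uniform point, up to a constant
factor (`lintegral_mul_volume_hits_le`). The window `j - 1`, over which there is no control, removes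
a measure `O(c/j)` only, whatever it does.

Let `a_j(x)` be the measure of `V_j(x)`. While `a_i ≥ i ^ (-1/2)` for all `i < j`, each step changes
`a` by a small proportion, and the expectation `e_j` of `a_j ^ (-6)` on this event satisfies
`e_{j+1} ≤ e_j + e_{j-1} / j`, hence `e_j ≤ j` (`GridSieve.lintegral_weight_le`). By Markov's
inequality `a_j` drops below `j ^ (-1/2)` for the first time at `j` with probability at most
`j / j^3 = 1 / j^2`, which is summable. Starting the sieve at a late window `s` makes the
exceptional set as small as desired.
-/

open MeasureTheory Set Filter Topology

/-! ### Distance to the nearest integer and hits of an arc -/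

theorem distInt_le_add (y z : ℝ) : distInt y ≤ distInt z + |y - z| := by
  have h1 := distInt_le y (round z)
  have h2 : |y - round z| ≤ |y - z| + |z - round z| := abs_sub_le y z _
  unfold distInt at *
  linarith

theorem distInt_sub_one (y : ℝ) : distInt (y - 1) = distInt y := by
  simp [distInt, round_sub_one]

theorem continuous_distInt : Continuous distInt := by
  refine (LipschitzWith.of_dist_le_mul (K := 1) fun y z => ?_).continuous
  rw [Real.dist_eq, Real.dist_eq, NNReal.coe_one, one_mul, abs_le]
  have h1 := distInt_le_add y z
  have h2 := distInt_le_add z y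
  rw [abs_sub_comm] at h2
  constructor <;> linarith

/-- If `q * x` completes at least one period on an interval of length `ℓ`, then the proportion of
`x` there with `q * x` within `r` of `δ` modulo one exceeds the uniform value `2 * r` at most by the
factor `3`, which absorbs the two incomplete periods at the ends. -/
theorem volume_distInt_lt_le {q ℓ r : ℝ} (a δ : ℝ) (hr : 0 ≤ r) (hℓ : 0 < ℓ) (hq : 1 ≤ |q| * ℓ) :
    volume {x ∈ Icc a (a + ℓ) | distInt (q * x - δ) < r} ≤ ENNReal.ofReal (6 * r * ℓ) := by
  have hq0 : 0 < |q| := by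
    by_contra h
    nlinarith [abs_nonneg q]
  have hq1 : q ≠ 0 := abs_pos.mp hq0
  set y := q * (a + ℓ / 2) - δ with hy
  set h := 1 / 2 + |q| * ℓ / 2 with hh
  have hsub : {x ∈ Icc a (a + ℓ) | distInt (q * x - δ) < r} ⊆
      ⋃ m ∈ Finset.Icc ⌈y - h⌉ ⌊y + h⌋, Metric.ball ((δ + (m : ℝ)) / q) (r / |q|) := by
    rintro x ⟨⟨hx1, hx2⟩, hx⟩
    have e1 : |q * x - δ - y| ≤ |q| * ℓ / 2 := by
      have : q * x - δ - y = q * (x - (a + ℓ / 2)) := by rw [hy]; ring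
      rw [this, abs_mul, mul_div_assoc]
      refine mul_le_mul_of_nonneg_left ?_ hq0.le
      rw [abs_le]; constructor <;> linarith
    have e2 : |q * x - δ - round (q * x - δ)| ≤ 1 / 2 := abs_sub_round _
    rw [abs_le] at e1 e2
    refine mem_iUnion₂.mpr ⟨round (q * x - δ), Finset.mem_Icc.mpr ⟨Int.ceil_le.mpr ?_,
      Int.le_floor.mpr ?_⟩, ?_⟩
    · linarith
    · linarith
    · rw [Metric.mem_ball, Real.dist_eq, lt_div_iff₀ hq0, ← abs_mul, sub_mul,
        div_mul_cancel₀ _ hq1]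
      unfold distInt at hx
      rw [show x * q - (δ + (round (q * x - δ) : ℝ)) = q * x - δ - round (q * x - δ) by ring]
      exact hx
  have hcard : ((Finset.Icc ⌈y - h⌉ ⌊y + h⌋).card : ℝ) ≤ 3 * (|q| * ℓ) := by
    rw [Int.card_Icc]
    have h1 := Int.floor_le (y + h)
    have h2 := Int.le_ceil (y - h)
    have h3 : (((⌊y + h⌋ + 1 - ⌈y - h⌉).toNat : ℤ) : ℝ) ≤ 3 * (|q| * ℓ) := by
      rw [Int.toNat_eq_max]
      push_cast
      refine max_le ?_ (by linarith)
      linarith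
    exact_mod_cast h3
  calc volume {x ∈ Icc a (a + ℓ) | distInt (q * x - δ) < r}
      ≤ ∑ m ∈ Finset.Icc ⌈y - h⌉ ⌊y + h⌋, volume (Metric.ball ((δ + (m : ℝ)) / q) (r / |q|)) :=
        (measure_mono hsub).trans (measure_biUnion_finset_le _ _)
    _ = ENNReal.ofReal ((Finset.Icc ⌈y - h⌉ ⌊y + h⌋).card * (2 * (r / |q|))) := by
        simp only [Real.volume_ball, Finset.sum_const, nsmul_eq_mul]
        rw [ENNReal.ofReal_mul (Nat.cast_nonneg _), ENNReal.ofReal_natCast]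
    _ ≤ ENNReal.ofReal (6 * r * ℓ) := by
        refine ENNReal.ofReal_le_ofReal ?_
        calc _ ≤ 3 * (|q| * ℓ) * (2 * (r / |q|)) :=
              mul_le_mul_of_nonneg_right hcard (by positivity)
          _ = 6 * r * ℓ := by field_simp; ring

theorem volume_inter_distInt_lt_le {r : ℝ} (hr : 0 ≤ r) (y : ℝ) :
    volume {δ ∈ Icc (0 : ℝ) 1 | distInt (y - δ) < r} ≤ ENNReal.ofReal (6 * r) := by
  have := volume_distInt_lt_le (q := -1) (ℓ := 1) 0 (-y) hr one_pos (by norm_num)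
  rw [mul_one, zero_add] at this
  simpa only [neg_one_mul, neg_sub_neg] using this

/-! ### Functions constant on the cells of a grid -/

/-- `f` is constant on each of the grid cells `[k/N, (k+1)/N)`. -/
def CellConst {α : Type*} (N : ℕ) (f : ℝ → α) : Prop :=
  ∀ x y : ℝ, ⌊N * x⌋ = ⌊N * y⌋ → f x = f y

theorem floor_mul_cell {N : ℕ} (hN : 0 < N) {x : ℝ} (k : ℕ) :
    ⌊N * x⌋ = (k : ℤ) ↔ x ∈ Ico ((k : ℝ) / N) ((k : ℝ) / N + 1 / N) := by
  have hN' : (0 : ℝ) < N := by exact_mod_cast hN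
  rw [Int.floor_eq_iff, Int.cast_natCast, mem_Ico, div_le_iff₀ hN', ← add_div,
    lt_div_iff₀ hN', mul_comm]

theorem CellConst.measurable {α : Type*} [MeasurableSpace α] {N : ℕ} {f : ℝ → α} (hN : 0 < N)
    (hf : CellConst N f) : Measurable f := by
  have hN' : (0 : ℝ) < N := by exact_mod_cast hN
  have : f = (fun k : ℤ => f (k / N)) ∘ fun x : ℝ => ⌊N * x⌋ := by
    funext x
    refine hf _ _ ?_
    rw [mul_div_cancel₀ _ hN'.ne', Int.floor_intCast]
  rw [this]
  exact (measurable_of_countable _).comp (Int.measurable_floor.comp (measurable_const_mul _))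

theorem CellConst.mono {α : Type*} {M N : ℕ} {f : ℝ → α} (h : M ∣ N) (hN : 0 < N)
    (hf : CellConst M f) : CellConst N f := by
  obtain ⟨d, rfl⟩ := h
  have hd : (0 : ℝ) < d := by exact_mod_cast Nat.pos_of_mul_pos_left hN
  have key : ∀ x : ℝ, ⌊(M : ℝ) * x⌋ = ⌊((M * d : ℕ) : ℝ) * x⌋ / (d : ℤ) := by
    intro x
    rw [← Int.floor_div_natCast]
    congr 1
    push_cast
    field_simp
  intro x y hxy
  exact hf x y (by rw [key, key, hxy])

/-- Averaged over an interval of `x` on which `q * x` completes at least one period, an arc of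
radius `r` around `q * x` meets a fixed set `U` in measure at most `6 * r` times that of `U`. -/
theorem lintegral_cell_le {q r ℓ : ℝ} (a : ℝ) (hr : 0 ≤ r) (hℓ : 0 < ℓ) (hq : 1 ≤ |q| * ℓ)
    {U : Set ℝ} (hU : MeasurableSet U) :
    ∫⁻ x in Ico a (a + ℓ), volume {δ ∈ U | distInt (q * x - δ) < r} ≤
      ENNReal.ofReal (6 * r * ℓ) * volume U := by
  set S : Set (ℝ × ℝ) := {z | z.2 ∈ U ∧ distInt (q * z.1 - z.2) < r} with hS
  have hSm : MeasurableSet S := by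
    have h1 : Measurable fun z : ℝ × ℝ => distInt (q * z.1 - z.2) :=
      continuous_distInt.measurable.comp (by fun_prop)
    exact (measurable_snd hU).inter (measurableSet_lt h1 measurable_const)
  calc ∫⁻ x in Ico a (a + ℓ), volume {δ ∈ U | distInt (q * x - δ) < r}
      = ((volume.restrict (Ico a (a + ℓ))).prod volume) S := by
        rw [Measure.prod_apply hSm]; rfl
    _ = ∫⁻ δ, (volume.restrict (Ico a (a + ℓ))) {x | δ ∈ U ∧ distInt (q * x - δ) < r} := by
        rw [Measure.prod_apply_symm hSm]; rfl
    _ ≤ ∫⁻ δ, U.indicator (fun _ => ENNReal.ofReal (6 * r * ℓ)) δ := by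
        refine lintegral_mono fun δ => ?_
        by_cases hδ : δ ∈ U
        · simp only [hδ, true_and, indicator_of_mem]
          rw [Measure.restrict_apply' measurableSet_Ico]
          refine (measure_mono ?_).trans (volume_distInt_lt_le a δ hr hℓ hq)
          rintro x ⟨h1, h2⟩
          exact ⟨Ico_subset_Icc_self h2, h1⟩
        · simp [hδ]
    _ = _ := by rw [lintegral_indicator hU, setLIntegral_const]

theorem iUnion_cells {N : ℕ} (hN : 0 < N) :
    Ico (0 : ℝ) 1 = ⋃ k ∈ Finset.range N, Ico ((k : ℝ) / N) ((k : ℝ) / N + 1 / N) := by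
  have hN' : (0 : ℝ) < N := by exact_mod_cast hN
  ext x
  simp only [mem_iUnion, Finset.mem_range, exists_prop]
  constructor
  · rintro ⟨h0, h1⟩
    refine ⟨⌊N * x⌋₊, (Nat.floor_lt (by positivity)).mpr (by nlinarith), ?_⟩
    exact (floor_mul_cell hN _).mp (Int.natCast_floor_eq_floor (by positivity)).symm
  · rintro ⟨k, hk, h1, h2⟩
    have hk' : (k : ℝ) + 1 ≤ N := by exact_mod_cast hk
    refine ⟨le_trans (by positivity) h1, h2.trans_le ?_⟩
    rw [← add_div]
    exact (div_le_one hN').mpr hk'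

theorem lintegral_Ico_eq_sum_cells {N : ℕ} (hN : 0 < N) (F : ℝ → ENNReal) :
    ∫⁻ x in Ico (0 : ℝ) 1, F x =
      ∑ k ∈ Finset.range N, ∫⁻ x in Ico ((k : ℝ) / N) ((k : ℝ) / N + 1 / N), F x := by
  rw [iUnion_cells hN, lintegral_biUnion_finset]
  · intro i _ j _ hij
    refine disjoint_left.mpr fun x hx hx' => hij ?_
    have h1 := (floor_mul_cell hN i).mpr hx
    have h2 := (floor_mul_cell hN j).mpr hx'
    exact_mod_cast h1.symm.trans h2
  · exact fun _ _ => measurableSet_Ico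

/-- The quasi-independence estimate: if the weight `f` and the random set `U` depend only on the
cell of `x` in a grid of mesh at least `1 / |q|`, then an arc of radius `r` around `q * x` removes
from `U`, in weighted mean, at most the proportion `6 * r`. -/
theorem lintegral_mul_volume_hits_le {N : ℕ} (hN : 0 < N) {q r : ℝ} (hr : 0 ≤ r)
    (hq : (N : ℝ) ≤ |q|) {f : ℝ → ENNReal} (hf : CellConst N f) (hf' : ∀ x, f x ≠ ⊤)
    {U : ℝ → Set ℝ} (hU : CellConst N U) (hUm : ∀ x, MeasurableSet (U x)) :
    ∫⁻ x in Ico (0 : ℝ) 1, f x * volume {δ ∈ U x | distInt (q * x - δ) < r} ≤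
      ENNReal.ofReal (6 * r) * ∫⁻ x in Ico (0 : ℝ) 1, f x * volume (U x) := by
  have hN' : (0 : ℝ) < N := by exact_mod_cast hN
  rw [lintegral_Ico_eq_sum_cells hN, lintegral_Ico_eq_sum_cells hN, Finset.mul_sum]
  refine Finset.sum_le_sum fun k _ => ?_
  set a := (k : ℝ) / N
  have hcell : ∀ x ∈ Ico a (a + 1 / N), ⌊N * x⌋ = ⌊N * a⌋ := by
    intro x hx
    rw [(floor_mul_cell hN k).mpr hx, (floor_mul_cell hN k).mpr (by simpa [a] using hN)]
  have e1 : ∫⁻ x in Ico a (a + 1 / N), f x * volume {δ ∈ U x | distInt (q * x - δ) < r} =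
      ∫⁻ x in Ico a (a + 1 / N), f a * volume {δ ∈ U a | distInt (q * x - δ) < r} :=
    setLIntegral_congr_fun measurableSet_Ico fun x hx => by
      simp only [hf _ _ (hcell x hx), hU _ _ (hcell x hx)]
  have e2 : ∫⁻ x in Ico a (a + 1 / N), f x * volume (U x) =
      ∫⁻ x in Ico a (a + 1 / N), f a * volume (U a) :=
    setLIntegral_congr_fun measurableSet_Ico fun x hx => by
      simp only [hf _ _ (hcell x hx), hU _ _ (hcell x hx)]
  rw [e1, e2, lintegral_const_mul' _ _ (hf' a), setLIntegral_const, Real.volume_Ico]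
  refine (mul_le_mul_right (lintegral_cell_le (q := q) (r := r) (ℓ := 1 / N) a hr (by positivity)
    ?_ (hUm a)) (f a)).trans_eq ?_
  · rwa [mul_one_div, one_le_div hN']
  · rw [ENNReal.ofReal_mul (by positivity), add_sub_cancel_left]
    ring

/-! ### The measure of the survivors -/

/-- The left endpoint of the cell `[k/N, (k+1)/N)` that contains `x`. -/
noncomputable def gridPoint (N : ℕ) (x : ℝ) : ℝ := ⌊N * x⌋ / N

theorem cellConst_gridPoint (N : ℕ) : CellConst N (gridPoint N) := fun x y h => by
  simp only [gridPoint, h]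

theorem abs_sub_gridPoint_le {N : ℕ} (hN : 0 < N) (x : ℝ) : |x - gridPoint N x| ≤ 1 / N := by
  have hN' : (0 : ℝ) < N := by exact_mod_cast hN
  have h : x - gridPoint N x = Int.fract (N * x) / N := by
    rw [gridPoint, Int.fract]
    field_simp
  rw [h, abs_of_nonneg (by have := Int.fract_nonneg (N * x); positivity)]
  gcongr
  exact (Int.fract_lt_one _).le

/-- The data of a sieve that starts at window `s`: frequencies `q n`, radii `r n`, windows `W j` of
indices, and grids of mesh `1 / N j`, each refining the previous ones. The grid `j` is so fine that
rounding `x` to it moves `q n * x` by at most `r n` for `n` in window `j` (`fine`), and so coarse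
that `q n * x` runs through a full period on its cells for `n` in window `j + 2` (`coarse`). The
constant `432 = 24 * 6 * 3` in `sum_le` is the product of the factor in `inv_pow_six_le`, that of
`lintegral_mul_volume_hits_le`, and that of the enlarged radius `3 * r n`. Conditions on the grids
begin at index `s - 2`, the grid on which the first window is averaged. -/
structure GridSieve (s : ℕ) where
  q : ℕ → ℝ
  r : ℕ → ℝ
  W : ℕ → Finset ℕ
  N : ℕ → ℕ
  two_le : 2 ≤ s
  r_nonneg : ∀ n, 0 ≤ r n
  N_pos : ∀ j, 0 < N j
  dvd : ∀ i j, s ≤ i + 2 → i ≤ j → N i ∣ N j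
  fine : ∀ j, s ≤ j → ∀ n ∈ W j, |q n| ≤ r n * N j
  coarse : ∀ j, s ≤ j + 2 → ∀ n ∈ W (j + 2), (N j : ℝ) ≤ |q n|
  sum_le : ∀ j, s ≤ j → ∑ n ∈ W j, r n ≤ 1 / (432 * j)

namespace GridSieve

variable {s : ℕ} (S : GridSieve s)

/-- The `δ ∈ [0, 1]` outside all arcs of the windows `s ≤ i < j`. The arcs are centred at the
rounded points and have twice the radius, so that they contain the arcs to be avoided. -/
def survivors (j : ℕ) (x : ℝ) : Set ℝ :=
  {δ ∈ Icc (0 : ℝ) 1 | ∀ i ∈ Finset.Ico s j, ∀ n ∈ S.W i,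
    2 * S.r n ≤ distInt (S.q n * gridPoint (S.N i) x - δ)}

/-- The Lebesgue measure of the survivors. -/
noncomputable def mass (j : ℕ) (x : ℝ) : ℝ := volume.real (S.survivors j x)

/-- An upper bound for the measure that window `j` removes: the arcs of window `j`, intersected with
the survivors as they were one window earlier. Those survivors depend only on the cell of `x` in the
grid `j - 2`, for which the points of window `j` are still equidistributed. -/
noncomputable def loss (j : ℕ) (x : ℝ) : ℝ :=
  ∑ n ∈ S.W j, volume.real {δ ∈ S.survivors (j - 1) x |
    distInt (S.q n * gridPoint (S.N j) x - δ) < 2 * S.r n}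

/-- The survivors have had measure at least `i ^ (-1/2)` at each stage `s ≤ i < j`. -/
def Thick (j : ℕ) (x : ℝ) : Prop := ∀ i ∈ Finset.Ico s j, 1 ≤ S.mass i x ^ 2 * i

open Classical in
/-- The potential `mass ^ (-m)`, restricted to the event `Thick`. -/
noncomputable def weight (m j : ℕ) (x : ℝ) : ℝ :=
  if S.Thick j x then (S.mass j x)⁻¹ ^ m else 0

theorem isClosed_survivors (j : ℕ) (x : ℝ) : IsClosed (S.survivors j x) := by
  have : S.survivors j x = Icc (0 : ℝ) 1 ∩ ⋂ i ∈ Finset.Ico s j, ⋂ n ∈ S.W i,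
      {δ | 2 * S.r n ≤ distInt (S.q n * gridPoint (S.N i) x - δ)} := by
    ext δ
    simp [survivors]
  rw [this]
  refine isClosed_Icc.inter (isClosed_biInter fun i _ => isClosed_biInter fun n _ => ?_)
  exact isClosed_le continuous_const (continuous_distInt.comp (by fun_prop))

theorem survivors_subset (j : ℕ) (x : ℝ) : S.survivors j x ⊆ Icc 0 1 := fun _ h => h.1

theorem survivors_anti {i j : ℕ} (h : i ≤ j) (x : ℝ) : S.survivors j x ⊆ S.survivors i x :=
  fun _ hδ => ⟨hδ.1, fun k hk => hδ.2 k (Finset.Ico_subset_Ico_right h hk)⟩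

theorem survivors_eq_Icc {j : ℕ} (h : j ≤ s) (x : ℝ) : S.survivors j x = Icc 0 1 := by
  ext δ
  simp [survivors, Finset.Ico_eq_empty_of_le h]

theorem volume_ne_top_of_subset {A : Set ℝ} (h : A ⊆ Icc 0 1) : volume A ≠ ⊤ :=
  measure_ne_top_of_subset h (by simp)

theorem mass_nonneg (j : ℕ) (x : ℝ) : 0 ≤ S.mass j x := measureReal_nonneg

theorem mass_anti {i j : ℕ} (h : i ≤ j) (x : ℝ) : S.mass j x ≤ S.mass i x :=
  measureReal_mono (S.survivors_anti h x) (volume_ne_top_of_subset (S.survivors_subset i x))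

theorem mass_eq_one {j : ℕ} (h : j ≤ s) (x : ℝ) : S.mass j x = 1 := by
  simp [mass, S.survivors_eq_Icc h]

theorem mass_le_one (j : ℕ) (x : ℝ) : S.mass j x ≤ 1 := by
  rw [← S.mass_eq_one (Nat.zero_le s) x]
  exact S.mass_anti (Nat.zero_le j) x

theorem ofReal_mass (j : ℕ) (x : ℝ) : ENNReal.ofReal (S.mass j x) = volume (S.survivors j x) :=
  ENNReal.ofReal_toReal (volume_ne_top_of_subset (S.survivors_subset j x))

theorem loss_nonneg (j : ℕ) (x : ℝ) : 0 ≤ S.loss j x :=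
  Finset.sum_nonneg fun _ _ => measureReal_nonneg

/-- The survivors of the windows before `j` use the grids up to `j - 1` only. -/
theorem cellConst_survivors {j k : ℕ} (h : j ≤ k + 1) :
    CellConst (S.N k) (S.survivors j) := by
  intro x y hxy
  have key : ∀ i ∈ Finset.Ico s j, gridPoint (S.N i) x = gridPoint (S.N i) y := by
    intro i hi
    rw [Finset.mem_Ico] at hi
    exact (cellConst_gridPoint _).mono (S.dvd i k (by omega) (by omega)) (S.N_pos k) x y hxy
  ext δ
  refine and_congr_right fun _ => forall₂_congr fun i hi => ?_
  rw [key i hi]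

theorem cellConst_mass {j k : ℕ} (h : j ≤ k + 1) :
    CellConst (S.N k) (S.mass j) := fun x y hxy => by
  simp only [mass, S.cellConst_survivors h x y hxy]

theorem cellConst_thick {j k : ℕ} (h : j ≤ k + 1) :
    CellConst (S.N k) (S.Thick j) := fun x y hxy => by
  refine propext (forall₂_congr fun i hi => ?_)
  rw [Finset.mem_Ico] at hi
  rw [S.cellConst_mass (by omega) x y hxy]

theorem cellConst_weight (m : ℕ) {j k : ℕ} (h : j ≤ k + 1) :
    CellConst (S.N k) (S.weight m j) := fun x y hxy => by
  have h1 := S.cellConst_thick h x y hxy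
  rw [weight, weight, S.cellConst_mass h x y hxy]
  congr

theorem weight_nonneg (m j : ℕ) (x : ℝ) : 0 ≤ S.weight m j x := by
  unfold weight
  split_ifs
  · have := S.mass_nonneg j x
    positivity
  · exact le_rfl

theorem weight_mul_mass (j : ℕ) (x : ℝ) : S.weight 7 j x * S.mass j x = S.weight 6 j x := by
  unfold weight
  split_ifs
  · rcases (S.mass_nonneg j x).eq_or_lt with h | h
    · simp [← h]
    · field_simp
  · simp

theorem mass_sub_loss_le {j : ℕ} (x : ℝ) : S.mass j x - S.loss j x ≤ S.mass (j + 1) x := by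
  have hsub : S.survivors j x ⊆ S.survivors (j + 1) x ∪ ⋃ n ∈ S.W j,
      {δ ∈ S.survivors (j - 1) x |
        distInt (S.q n * gridPoint (S.N j) x - δ) < 2 * S.r n} := by
    intro δ hδ
    by_cases h : ∃ n ∈ S.W j, distInt (S.q n * gridPoint (S.N j) x - δ) < 2 * S.r n
    · obtain ⟨n, hn, h⟩ := h
      exact Or.inr (mem_iUnion₂.mpr ⟨n, hn, S.survivors_anti (Nat.sub_le j 1) x hδ, h⟩)
    · push Not at h
      refine Or.inl ⟨hδ.1, fun i hi => ?_⟩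
      rw [Finset.mem_Ico] at hi
      rcases (Nat.lt_succ_iff.mp hi.2).eq_or_lt with rfl | hij
      · exact h
      · exact hδ.2 i (Finset.mem_Ico.mpr ⟨hi.1, hij⟩)
  have hU : (⋃ n ∈ S.W j, {δ ∈ S.survivors (j - 1) x |
        distInt (S.q n * gridPoint (S.N j) x - δ) < 2 * S.r n}) ⊆ Icc 0 1 :=
    iUnion₂_subset fun n _ δ h => h.1.1
  have h1 := measureReal_mono (μ := volume) hsub
    (volume_ne_top_of_subset (union_subset (S.survivors_subset _ x) hU))
  have h2 := measureReal_union_le (μ := volume) (S.survivors (j + 1) x) (⋃ n ∈ S.W j,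
      {δ ∈ S.survivors (j - 1) x |
        distInt (S.q n * gridPoint (S.N j) x - δ) < 2 * S.r n})
  have h3 := measureReal_biUnion_finset_le (μ := volume) (S.W j)
      fun n => {δ ∈ S.survivors (j - 1) x |
        distInt (S.q n * gridPoint (S.N j) x - δ) < 2 * S.r n}
  unfold mass loss
  linarith

theorem loss_le {j : ℕ} (hj : s ≤ j) (x : ℝ) : S.loss j x ≤ 1 / (36 * j) := by
  have h : ∀ n ∈ S.W j, volume.real {δ ∈ S.survivors (j - 1) x |
      distInt (S.q n * gridPoint (S.N j) x - δ) < 2 * S.r n} ≤ 12 * S.r n := by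
    intro n _
    have hr := S.r_nonneg n
    refine ENNReal.toReal_le_of_le_ofReal (by positivity) ?_
    refine (measure_mono fun δ hδ => ?_).trans
      ((volume_inter_distInt_lt_le (r := 2 * S.r n) (by positivity)
        (S.q n * gridPoint (S.N j) x)).trans_eq (by congr 1; ring))
    exact ⟨hδ.1.1, hδ.2⟩
  have h2 := S.sum_le j hj
  calc S.loss j x ≤ ∑ n ∈ S.W j, 12 * S.r n := Finset.sum_le_sum h
    _ = 12 * ∑ n ∈ S.W j, S.r n := (Finset.mul_sum ..).symm
    _ ≤ 12 * (1 / (432 * j)) := by gcongr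
    _ = 1 / (36 * j) := by
      rw [← div_div, ← div_div]; ring

theorem one_div_le_mass {j : ℕ} {x : ℝ} (hj : 0 < j) (h : 1 ≤ S.mass j x ^ 2 * j) :
    1 / (j : ℝ) ≤ S.mass j x := by
  have hj' : (0 : ℝ) < j := by exact_mod_cast hj
  rw [div_le_iff₀ hj']
  nlinarith [S.mass_le_one j x, S.mass_nonneg j x,
    mul_nonneg (S.mass_nonneg j x) hj'.le]

theorem loss_le_mass {j : ℕ} {x : ℝ} (hj : s ≤ j) (h : 1 ≤ S.mass j x ^ 2 * j) :
    S.loss j x ≤ S.mass j x / 36 := by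
  have h1 := S.loss_le hj x
  have h2 := S.one_div_le_mass (by have := S.two_le; omega) h
  rw [one_div, mul_inv] at h1
  rw [one_div] at h2
  linarith

/-- On the event `Thick` the last step has removed only a small proportion. Its hypothesis bounds
the mass from below at the stages before `j` only, so this is what keeps the mass positive at `j`.
-/
theorem Thick.mass_ratio {S : GridSieve s} {j : ℕ} {x : ℝ} (hj : s ≤ j) (h : S.Thick j x) :
    0 < S.mass (j - 1) x ∧ 13 / 14 * S.mass (j - 1) x ≤ S.mass j x := by
  rcases hj.eq_or_lt with rfl | hj
  · rw [S.mass_eq_one le_rfl, S.mass_eq_one (Nat.sub_le _ _)]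
    norm_num
  · obtain ⟨k, rfl⟩ : ∃ k, j = k + 1 := ⟨j - 1, by omega⟩
    rw [Nat.add_sub_cancel]
    have hk : s ≤ k := by omega
    have hk0 : 0 < k := by have := S.two_le; omega
    have h1 := h k (Finset.mem_Ico.mpr ⟨hk, by omega⟩)
    have h2 := S.loss_le_mass hk h1
    have h3 := S.mass_sub_loss_le (j := k) x
    have h4 : 0 < S.mass k x :=
      lt_of_lt_of_le (by positivity) (S.one_div_le_mass hk0 h1)
    exact ⟨h4, by linarith⟩

theorem inv_pow_six_le {a a' b d : ℝ} (hb : 0 < b) (hab : 13 / 14 * b ≤ a) (hd : 0 ≤ d)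
    (hda : d ≤ a / 36) (ha' : a - d ≤ a') : a'⁻¹ ^ 6 ≤ a⁻¹ ^ 6 + 24 * (b⁻¹ ^ 7 * d) := by
  have ha : 0 < a := by linarith
  have h1 : 0 < a - d := by linarith
  have h2 : a'⁻¹ ^ 6 ≤ (a - d)⁻¹ ^ 6 := by
    have : 0 < a' := by linarith
    gcongr
  have h3 : (a - d)⁻¹ ^ 6 ≤ a⁻¹ ^ 6 + 12 * (a⁻¹ ^ 7 * d) := by
    have hu : d / a ≤ 1 / 36 := by rw [div_le_iff₀ ha]; linarith
    have hu0 : 0 ≤ d / a := by positivity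
    set u := d / a with hu_def
    have hd' : d = a * u := by rw [hu_def]; field_simp
    have hB : 1 - 6 * u ≤ (1 - u) ^ 6 := by
      have := one_add_mul_le_pow (a := -u) (by linarith) 6
      push_cast at this
      rw [← sub_eq_add_neg] at this
      linarith
    have h4 : ((1 - u) ^ 6)⁻¹ ≤ 1 + 12 * u := by
      rw [inv_le_iff_one_le_mul₀ (by have : 0 < 1 - u := by linarith
                                     positivity)]
      nlinarith
    have e1 : (a - d)⁻¹ ^ 6 = a⁻¹ ^ 6 * ((1 - u) ^ 6)⁻¹ := by
      rw [hd', ← mul_one_sub, mul_inv, mul_pow, inv_pow (1 - u)]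
    have e2 : a⁻¹ ^ 6 + 12 * (a⁻¹ ^ 7 * d) = a⁻¹ ^ 6 * (1 + 12 * u) := by
      rw [hd']
      field_simp
    rw [e1, e2]
    gcongr
  have h5 : a⁻¹ ^ 7 ≤ 2 * b⁻¹ ^ 7 := by
    calc a⁻¹ ^ 7 ≤ (13 / 14 * b)⁻¹ ^ 7 := by gcongr
      _ = (14 / 13) ^ 7 * b⁻¹ ^ 7 := by rw [mul_inv, mul_pow]; norm_num
      _ ≤ 2 * b⁻¹ ^ 7 := by gcongr; norm_num
  nlinarith [mul_le_mul_of_nonneg_right h5 hd]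

/-- One step of the potential, with the increment written in terms of stage `j - 1` so that it can
be averaged over the cells of the grid `j - 2`. -/
theorem weight_succ_le {j : ℕ} (hj : s ≤ j) (x : ℝ) :
    S.weight 6 (j + 1) x ≤ S.weight 6 j x + 24 * (S.weight 7 (j - 1) x * S.loss j x) := by
  by_cases h : S.Thick (j + 1) x
  · have h0 : S.Thick j x := fun i hi => h i (Finset.Ico_subset_Ico_right (Nat.le_succ j) hi)
    have h1 : S.Thick (j - 1) x := fun i hi =>
      h0 i (Finset.Ico_subset_Ico_right (Nat.sub_le j 1) hi)
    have h2 := h j (Finset.mem_Ico.mpr ⟨hj, Nat.lt_succ_self j⟩)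
    obtain ⟨h3, h4⟩ := h0.mass_ratio hj
    simp only [weight, h, h0, h1, if_true]
    exact inv_pow_six_le h3 h4 (S.loss_nonneg j x) (S.loss_le_mass hj h2) (S.mass_sub_loss_le x)
  · have h1 := S.weight_nonneg 6 j x
    have h2 := S.weight_nonneg 7 (j - 1) x
    have h3 := S.loss_nonneg j x
    rw [weight, if_neg h]
    positivity

theorem lintegral_weight_mul_loss_le {j : ℕ} (hj : s ≤ j) :
    ∫⁻ x in Ico (0 : ℝ) 1, ENNReal.ofReal (24 * (S.weight 7 (j - 1) x * S.loss j x)) ≤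
      ENNReal.ofReal (1 / j) * ∫⁻ x in Ico (0 : ℝ) 1, ENNReal.ofReal (S.weight 6 (j - 1) x) := by
  -- As `s ≥ 2`, the grid `j - 2` always exists.
  obtain ⟨k, rfl⟩ : ∃ k, j = k + 2 := ⟨j - 2, by have := S.two_le; omega⟩
  rw [show k + 2 - 1 = k + 1 from rfl]
  set w : ℝ → ENNReal := fun x => ENNReal.ofReal (S.weight 7 (k + 1) x)
  have hpt : ∀ x, ENNReal.ofReal (24 * (S.weight 7 (k + 1) x * S.loss (k + 2) x)) =
      ∑ n ∈ S.W (k + 2), 24 * (w x * volume {δ ∈ S.survivors (k + 1) x |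
        distInt (S.q n * gridPoint (S.N (k + 2)) x - δ) < 2 * S.r n}) := by
    intro x
    rw [ENNReal.ofReal_mul (by norm_num), ENNReal.ofReal_mul (S.weight_nonneg _ _ x), loss,
      ENNReal.ofReal_sum_of_nonneg fun _ _ => measureReal_nonneg, Finset.mul_sum, Finset.mul_sum]
    refine Finset.sum_congr rfl fun n _ => ?_
    rw [ofReal_measureReal (volume_ne_top_of_subset fun δ hδ =>
      S.survivors_subset _ x hδ.1)]
    norm_num [w]
  have hterm : ∀ n ∈ S.W (k + 2),
      ∫⁻ x in Ico (0 : ℝ) 1, 24 * (w x * volume {δ ∈ S.survivors (k + 1) x |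
        distInt (S.q n * gridPoint (S.N (k + 2)) x - δ) < 2 * S.r n}) ≤
      ENNReal.ofReal (432 * S.r n) *
        ∫⁻ x in Ico (0 : ℝ) 1, ENNReal.ofReal (S.weight 6 (k + 1) x) := by
    intro n hn
    have hr := S.r_nonneg n
    rw [lintegral_const_mul' _ _ (by norm_num)]
    have h1 : ∫⁻ x in Ico (0 : ℝ) 1, w x * volume {δ ∈ S.survivors (k + 1) x |
        distInt (S.q n * gridPoint (S.N (k + 2)) x - δ) < 2 * S.r n} ≤
        ∫⁻ x in Ico (0 : ℝ) 1, w x * volume {δ ∈ S.survivors (k + 1) x |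
          distInt (S.q n * x - δ) < 3 * S.r n} := by
      refine lintegral_mono fun x => ?_
      refine mul_le_mul_right (measure_mono ?_) (w x)
      intro δ hδ
      refine ⟨hδ.1, ?_⟩
      have hN := S.N_pos (k + 2)
      have h2 := distInt_le_add (S.q n * x - δ) (S.q n * gridPoint (S.N (k + 2)) x - δ)
      have h3 : |S.q n * x - δ - (S.q n * gridPoint (S.N (k + 2)) x - δ)| ≤ S.r n := by
        rw [sub_sub_sub_cancel_right, ← mul_sub, abs_mul]
        calc |S.q n| * |x - gridPoint (S.N (k + 2)) x|
            ≤ S.r n * S.N (k + 2) * (1 / S.N (k + 2)) :=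
              mul_le_mul (S.fine _ hj n hn) (abs_sub_gridPoint_le hN x) (abs_nonneg _)
                (by positivity)
          _ = S.r n := by field_simp
      have h4 := hδ.2
      linarith
    have h2 := lintegral_mul_volume_hits_le (S.N_pos k) (r := 3 * S.r n) (by positivity)
      (S.coarse k hj n hn) (f := w) (fun x y hxy => by
        simp only [w, S.cellConst_weight 7 le_rfl x y hxy]) (fun x => ENNReal.ofReal_ne_top)
      (S.cellConst_survivors le_rfl) (fun x => (S.isClosed_survivors _ x).measurableSet)
    have h3 : ∀ x, w x * volume (S.survivors (k + 1) x) =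
        ENNReal.ofReal (S.weight 6 (k + 1) x) := by
      intro x
      rw [← S.ofReal_mass, ← ENNReal.ofReal_mul (S.weight_nonneg _ _ x), S.weight_mul_mass]
    simp only [h3] at h2
    calc _ ≤ 24 * (ENNReal.ofReal (6 * (3 * S.r n)) *
          ∫⁻ x in Ico (0 : ℝ) 1, ENNReal.ofReal (S.weight 6 (k + 1) x)) := by
          gcongr
          exact h1.trans h2
      _ = _ := by
          rw [← mul_assoc, show (24 : ENNReal) = ENNReal.ofReal 24 by norm_num,
            ← ENNReal.ofReal_mul (by norm_num)]
          congr 2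
          ring
  simp only [hpt]
  rw [lintegral_finsetSum]
  · calc _ ≤ ∑ n ∈ S.W (k + 2), ENNReal.ofReal (432 * S.r n) *
          ∫⁻ x in Ico (0 : ℝ) 1, ENNReal.ofReal (S.weight 6 (k + 1) x) := Finset.sum_le_sum hterm
      _ ≤ _ := by
          rw [← Finset.sum_mul, ← ENNReal.ofReal_sum_of_nonneg, ← Finset.mul_sum]
          · gcongr
            have := S.sum_le _ hj
            calc 432 * ∑ n ∈ S.W (k + 2), S.r n
                ≤ 432 * (1 / (432 * ((k + 2 : ℕ) : ℝ))) := by gcongr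
              _ = 1 / ((k + 2 : ℕ) : ℝ) := by rw [← div_div]; ring
          · exact fun n _ => mul_nonneg (by norm_num) (S.r_nonneg n)
  · intro n _
    refine CellConst.measurable (S.N_pos (k + 2)) fun x y hxy => ?_
    simp only [w, S.cellConst_weight 7 (k := k + 2) (j := k + 1) (by omega) x y hxy,
      S.cellConst_survivors (k := k + 2) (j := k + 1) (by omega) x y hxy,
      cellConst_gridPoint _ x y hxy]

theorem measurable_weight (m j : ℕ) :
    Measurable fun x => ENNReal.ofReal (S.weight m j x) :=
  ENNReal.measurable_ofReal.comp
    (CellConst.measurable (S.N_pos j) (S.cellConst_weight m (by omega)))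

/-- The recursion `e (j + 1) ≤ e j + e (j - 1) / j` with initial values `1` gives linear growth. -/
theorem lintegral_weight_le {j : ℕ} (hj : s ≤ j + 1) :
    ∫⁻ x in Ico (0 : ℝ) 1, ENNReal.ofReal (S.weight 6 j x) ≤ j := by
  have hs := S.two_le
  have base : ∀ i, i ≤ s → 1 ≤ i →
      ∫⁻ x in Ico (0 : ℝ) 1, ENNReal.ofReal (S.weight 6 i x) ≤ i := by
    intro i hi hi1
    have : ∀ x, S.weight 6 i x = 1 := fun x => by
      rw [weight, if_pos, S.mass_eq_one hi]
      · norm_num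
      · intro k hk
        rw [Finset.mem_Ico] at hk
        omega
    simp only [this, ENNReal.ofReal_one, lintegral_const, MeasurableSet.univ,
      Measure.restrict_apply, univ_inter, Real.volume_Ico, sub_zero, one_mul]
    exact_mod_cast hi1
  induction j using Nat.strong_induction_on with
  | _ j ih =>
    rcases Nat.lt_or_ge s j with h | h
    · obtain ⟨k, rfl⟩ : ∃ k, j = k + 1 := ⟨j - 1, by omega⟩
      have hk : s ≤ k := by omega
      have h1 := ih k (by omega) (by omega)
      have h2 := ih (k - 1) (by omega) (by omega)
      calc ∫⁻ x in Ico (0 : ℝ) 1, ENNReal.ofReal (S.weight 6 (k + 1) x)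
          ≤ ∫⁻ x in Ico (0 : ℝ) 1, (ENNReal.ofReal (S.weight 6 k x) +
            ENNReal.ofReal (24 * (S.weight 7 (k - 1) x * S.loss k x))) :=
            lintegral_mono fun x => (ENNReal.ofReal_le_ofReal (S.weight_succ_le hk x)).trans
              ENNReal.ofReal_add_le
        _ = _ := lintegral_add_left (S.measurable_weight 6 k) _
        _ ≤ k + ENNReal.ofReal (1 / k) * (k - 1 : ℕ) :=
            add_le_add h1 ((S.lintegral_weight_mul_loss_le hk).trans (by gcongr))
        _ ≤ k + 1 := by
            gcongr
            rw [← ENNReal.ofReal_natCast, ← ENNReal.ofReal_mul (by positivity),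
              ENNReal.ofReal_le_one]
            have hk0 : (0 : ℝ) < k := by
              have : 0 < k := by omega
              exact_mod_cast this
            rw [one_div, inv_mul_le_one₀ hk0]
            exact_mod_cast Nat.sub_le k 1
        _ = _ := by push_cast; rfl
    · exact base j h (by omega)

/-- Markov's inequality for the potential: the mass falls below `j ^ (-1/2)` for the first time at
stage `j` with probability at most `j / j ^ 3`. -/
theorem volume_first_thin_le {j : ℕ} (hj : s ≤ j) :
    volume {x ∈ Ico (0 : ℝ) 1 | S.Thick j x ∧ S.mass j x ^ 2 * j < 1} ≤
      ENNReal.ofReal (1 / (j : ℝ) ^ 2) := by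
  have hj0 : (0 : ℝ) < j := by
    have : 0 < j := by have := S.two_le; omega
    exact_mod_cast this
  have hsub : {x ∈ Ico (0 : ℝ) 1 | S.Thick j x ∧ S.mass j x ^ 2 * j < 1} ⊆
      {x | ENNReal.ofReal ((j : ℝ) ^ 3) ≤ ENNReal.ofReal (S.weight 6 j x)} ∩ Ico 0 1 := by
    rintro x ⟨hx, h1, h2⟩
    refine ⟨ENNReal.ofReal_le_ofReal ?_, hx⟩
    rw [weight, if_pos h1]
    have h3 := h1.mass_ratio hj
    have h4 : 0 < S.mass j x := by linarith
    have h5 : (j : ℝ) ≤ (S.mass j x)⁻¹ ^ 2 := by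
      rw [inv_pow, le_inv_comm₀ hj0 (by positivity), le_inv_comm₀ (by positivity) hj0]
      rw [← one_div, le_div_iff₀ (by positivity)]
      linarith
    calc (j : ℝ) ^ 3 ≤ ((S.mass j x)⁻¹ ^ 2) ^ 3 := by gcongr
      _ = _ := by rw [← pow_mul]
  have h1 := mul_meas_ge_le_lintegral (μ := volume.restrict (Ico (0 : ℝ) 1))
    (S.measurable_weight 6 j) (ENNReal.ofReal ((j : ℝ) ^ 3))
  rw [Measure.restrict_apply' measurableSet_Ico] at h1
  have h2 := h1.trans (S.lintegral_weight_le (by omega))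
  have h3 := measure_mono (μ := volume) hsub
  have h4 : ENNReal.ofReal ((j : ℝ) ^ 3) ≠ 0 := by
    rw [ne_eq, ENNReal.ofReal_eq_zero, not_le]
    positivity
  calc _ ≤ _ := h3
    _ ≤ (j : ENNReal) / ENNReal.ofReal ((j : ℝ) ^ 3) := by
        rw [ENNReal.le_div_iff_mul_le (Or.inl h4) (Or.inl ENNReal.ofReal_ne_top), mul_comm]
        exact h2
    _ = ENNReal.ofReal (1 / (j : ℝ) ^ 2) := by
        rw [← ENNReal.ofReal_natCast, ← ENNReal.ofReal_div_of_pos (by positivity)]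
        congr 1
        field_simp

/-- If the mass never vanishes, the survivors form a decreasing sequence of nonempty compact sets; a
common point avoids the original arcs, since rounding costs one of the two radii. -/
theorem exists_of_mass {x : ℝ} (h : ∀ j, s ≤ j → 1 ≤ S.mass j x ^ 2 * j) :
    ∃ δ ∈ Icc (0 : ℝ) 1, ∀ j, s ≤ j → ∀ n ∈ S.W j, S.r n ≤ distInt (S.q n * x - δ) := by
  have hne : ∀ j, (S.survivors (s + j) x).Nonempty := by
    intro j
    rw [nonempty_iff_ne_empty]
    intro h0
    have h1 := h (s + j) (by omega)
    simp only [mass, h0, measureReal_empty] at h1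
    norm_num at h1
  obtain ⟨δ, hδ⟩ := IsCompact.nonempty_iInter_of_sequence_nonempty_isCompact_isClosed
    (fun j => S.survivors (s + j) x) (fun j => S.survivors_anti (by omega) x) hne
    (isCompact_Icc.of_isClosed_subset (S.isClosed_survivors _ x) (S.survivors_subset _ x))
    (fun j => S.isClosed_survivors _ x)
  rw [mem_iInter] at hδ
  refine ⟨δ, (hδ 0).1, fun j hj n hn => ?_⟩
  have h1 := (hδ (j + 1 - s)).2 j (Finset.mem_Ico.mpr ⟨hj, by omega⟩) n hn
  have hN := S.N_pos j
  have hr := S.r_nonneg n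
  have h2 := distInt_le_add (S.q n * gridPoint (S.N j) x - δ) (S.q n * x - δ)
  have h3 : |S.q n * gridPoint (S.N j) x - δ - (S.q n * x - δ)| ≤ S.r n := by
    rw [sub_sub_sub_cancel_right, ← mul_sub, abs_mul, abs_sub_comm]
    calc |S.q n| * |x - gridPoint (S.N j) x|
        ≤ S.r n * S.N j * (1 / S.N j) :=
          mul_le_mul (S.fine _ hj n hn) (abs_sub_gridPoint_le hN x) (abs_nonneg _)
            (by positivity)
      _ = S.r n := by field_simp
  linarith

/-- The exceptional `x` are split by the first stage at which the mass is too small. -/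
theorem volume_bad_le :
    volume {x ∈ Ico (0 : ℝ) 1 | ¬ ∃ δ ∈ Icc (0 : ℝ) 1, ∀ j, s ≤ j → ∀ n ∈ S.W j,
      S.r n ≤ distInt (S.q n * x - δ)} ≤ ∑' k : ℕ, ENNReal.ofReal (1 / ((k + s : ℕ) : ℝ) ^ 2) := by
  classical
  have hsub : {x ∈ Ico (0 : ℝ) 1 | ¬ ∃ δ ∈ Icc (0 : ℝ) 1, ∀ j, s ≤ j → ∀ n ∈ S.W j,
      S.r n ≤ distInt (S.q n * x - δ)} ⊆
      ⋃ k : ℕ, {x ∈ Ico (0 : ℝ) 1 | S.Thick (k + s) x ∧ S.mass (k + s) x ^ 2 * (k + s : ℕ) < 1} := by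
    rintro x ⟨hx, h⟩
    have hex : ∃ j, s ≤ j ∧ S.mass j x ^ 2 * j < 1 := by
      by_contra! h'
      exact h (S.exists_of_mass h')
    obtain ⟨h1, h2⟩ := Nat.find_spec hex
    refine mem_iUnion.mpr ⟨Nat.find hex - s, ?_⟩
    rw [Nat.sub_add_cancel h1]
    refine ⟨hx, fun i hi => ?_, h2⟩
    rw [Finset.mem_Ico] at hi
    have := Nat.find_min hex hi.2
    push Not at this
    exact this hi.1
  exact (measure_mono hsub).trans ((measure_iUnion_le _).trans
    (ENNReal.tsum_le_tsum fun k => S.volume_first_thin_le (by omega)))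

end GridSieve

/-! ### Growth across the windows -/

theorem succ_pow_le (p : ℕ) {j : ℕ} (hj : 0 < j) :
    (j + 1) ^ (p + 1) ≤ j ^ (p + 1) + 3 ^ (p + 1) * j ^ p := by
  induction p with
  | zero => simp
  | succ p ih =>
    have h1 : j ^ p ≤ j ^ (p + 1) := Nat.pow_le_pow_right hj (Nat.le_succ p)
    have h2 : 0 < j ^ (p + 1) := by positivity
    have h3 : 1 ≤ 3 ^ (p + 1) := Nat.one_le_pow _ _ (by norm_num)
    calc (j + 1) ^ (p + 1 + 1) = (j + 1) * (j + 1) ^ (p + 1) := by ring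
      _ ≤ (j + 1) * (j ^ (p + 1) + 3 ^ (p + 1) * j ^ p) := Nat.mul_le_mul_left _ ih
      _ = j ^ (p + 1 + 1) + (1 * j ^ (p + 1) + 3 ^ (p + 1) * j ^ (p + 1)
          + 3 ^ (p + 1) * j ^ p) := by ring
      _ ≤ j ^ (p + 1 + 1) + (3 ^ (p + 1) * j ^ (p + 1) + 3 ^ (p + 1) * j ^ (p + 1)
          + 3 ^ (p + 1) * j ^ (p + 1)) := by gcongr
      _ = _ := by ring

theorem sum_one_div_le (p : ℕ) {j : ℕ} (hj : 0 < j) :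
    ∑ n ∈ Finset.Ico (j ^ (p + 1)) ((j + 1) ^ (p + 1)), (1 : ℝ) / n ≤ 3 ^ (p + 1) / j := by
  have hj' : (0 : ℝ) < j := by exact_mod_cast hj
  have hcard : (((j + 1) ^ (p + 1) - j ^ (p + 1) : ℕ) : ℝ) ≤ 3 ^ (p + 1) * (j : ℝ) ^ p := by
    have := succ_pow_le p hj
    exact_mod_cast (by omega : (j + 1) ^ (p + 1) - j ^ (p + 1) ≤ 3 ^ (p + 1) * j ^ p)
  calc _ ≤ ∑ n ∈ Finset.Ico (j ^ (p + 1)) ((j + 1) ^ (p + 1)), (1 : ℝ) / (j : ℝ) ^ (p + 1) := by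
        refine Finset.sum_le_sum fun n hn => ?_
        have : (j : ℝ) ^ (p + 1) ≤ n := by exact_mod_cast (Finset.mem_Ico.mp hn).1
        gcongr
    _ = (((j + 1) ^ (p + 1) - j ^ (p + 1) : ℕ) : ℝ) * (1 / (j : ℝ) ^ (p + 1)) := by
        rw [Finset.sum_const, Nat.card_Ico, nsmul_eq_mul]
    _ ≤ 3 ^ (p + 1) * (j : ℝ) ^ p * (1 / (j : ℝ) ^ (p + 1)) := by gcongr
    _ = 3 ^ (p + 1) / j := by
        rw [pow_succ (j : ℝ) p]
        field_simp

/-- The total growth across the window from `t ^ (P + 2)`, which has at least `t ^ (P + 1)` steps of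
ratio at least `1 + 1 / (t + 1) ^ P`, beats every multiple of `t ^ (P + 2)`. -/
theorem eventually_mul_pow_le (P : ℕ) (C : ℝ) :
    ∀ᶠ t : ℕ in atTop, C * (t : ℝ) ^ (P + 2) ≤ (1 + 1 / ((t : ℝ) + 1) ^ P) ^ t ^ (P + 1) := by
  have h1 := (tendsto_pow_const_div_const_pow_of_one_lt ((P + 2) * 2 ^ P)
    (one_lt_two (α := ℝ))).const_mul (C ^ 2 ^ P)
  rw [mul_zero] at h1
  filter_upwards [h1.eventually (gt_mem_nhds one_pos), eventually_ge_atTop 1] with t ht ht1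
  have ht1' : (1 : ℝ) ≤ t := by exact_mod_cast ht1
  -- The base is `1 + 1 / M` with `M = (t + 1) ^ P`, and `M * t ≤ 2 ^ P * t ^ (P + 1)`: after
  -- raising to the power `2 ^ P`, Bernoulli's inequality makes the right side at least `2 ^ t`.
  refine le_of_pow_le_pow_left₀ (n := 2 ^ P) (by positivity) (by positivity) ?_
  rw [← mul_div_assoc, div_lt_one (by positivity)] at ht
  have hM : (2 : ℝ) ≤ (1 + 1 / ((t : ℝ) + 1) ^ P) ^ (t + 1) ^ P := by
    have hM0 : (0 : ℝ) < (t + 1) ^ P := by positivity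
    have := one_add_mul_le_pow (a := 1 / ((t : ℝ) + 1) ^ P)
      (by have : 0 < 1 / ((t : ℝ) + 1) ^ P := by positivity
          linarith) ((t + 1) ^ P)
    push_cast at this
    rw [mul_one_div_cancel hM0.ne'] at this
    linarith
  have hexp : (t + 1) ^ P * t ≤ t ^ (P + 1) * 2 ^ P := by
    calc (t + 1) ^ P * t ≤ (2 * t) ^ P * t := by gcongr; omega
      _ = _ := by rw [mul_pow]; ring
  calc (C * (t : ℝ) ^ (P + 2)) ^ 2 ^ P = C ^ 2 ^ P * (t : ℝ) ^ ((P + 2) * 2 ^ P) := by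
        rw [mul_pow, ← pow_mul]
    _ ≤ 2 ^ t := ht.le
    _ ≤ ((1 + 1 / ((t : ℝ) + 1) ^ P) ^ (t + 1) ^ P) ^ t := by gcongr
    _ = (1 + 1 / ((t : ℝ) + 1) ^ P) ^ ((t + 1) ^ P * t) := (pow_mul ..).symm
    _ ≤ (1 + 1 / ((t : ℝ) + 1) ^ P) ^ (t ^ (P + 1) * 2 ^ P) := by
        refine pow_le_pow_right₀ ?_ hexp
        have : 0 < 1 / ((t : ℝ) + 1) ^ P := by positivity
        linarith
    _ = _ := pow_mul ..

theorem mul_pow_le_of_step {Q : ℕ → ℝ} {b : ℝ} (hb : 0 ≤ b) {m k : ℕ}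
    (h : ∀ n, m ≤ n → n < m + k → Q n * b ≤ Q (n + 1)) : Q m * b ^ k ≤ Q (m + k) := by
  induction k with
  | zero => simp
  | succ k ih =>
    calc Q m * b ^ (k + 1) = Q m * b ^ k * b := by ring
      _ ≤ Q (m + k) * b := by
          gcongr
          exact ih fun n h1 h2 => h n h1 (by omega)
      _ ≤ _ := h _ (by omega) (by omega)

/-- Since `2 / (P + 2) ≤ ε`, the gap condition at indices up to `t ^ (P + 2)` gives a ratio of at
least `1 + 1 / t ^ P`. -/
theorem rpow_one_sub_le {ε : ℝ} {P t n : ℕ} (hP : 2 / ((P : ℝ) + 2) ≤ ε) (hn : 1 ≤ n)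
    (hnt : n ≤ t ^ (P + 2)) : (n : ℝ) ^ (1 - ε) ≤ (t : ℝ) ^ P := by
  have hP0 : (0 : ℝ) < (P : ℝ) + 2 := by positivity
  have hn' : (1 : ℝ) ≤ n := by exact_mod_cast hn
  calc (n : ℝ) ^ (1 - ε) ≤ (n : ℝ) ^ ((P : ℝ) / (P + 2)) := by
        refine Real.rpow_le_rpow_of_exponent_le hn' ?_
        have : (P : ℝ) / (P + 2) = 1 - 2 / (P + 2) := by field_simp; ring
        linarith
    _ ≤ ((t : ℝ) ^ (P + 2)) ^ ((P : ℝ) / (P + 2)) := by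
        refine Real.rpow_le_rpow (by positivity) (by exact_mod_cast hnt) (by positivity)
    _ = (t : ℝ) ^ P := by
        rw [← Real.rpow_natCast, ← Real.rpow_mul (by positivity), ← Real.rpow_natCast]
        congr 1
        push_cast
        field_simp

theorem eventually_window_growth {ε : ℝ} {P : ℕ} (hP : 2 / ((P : ℝ) + 2) ≤ ε) {Q : ℕ → ℝ} {n₀ : ℕ}
    (hQ : ∀ n, n₀ ≤ n → 0 < Q n)
    (hstep : ∀ n, n₀ ≤ n → Q n * (1 + 1 / (n : ℝ) ^ (1 - ε)) ≤ Q (n + 1)) (C : ℝ) :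
    ∀ᶠ t : ℕ in atTop, C * (t : ℝ) ^ (P + 2) * Q (t ^ (P + 2)) ≤ Q ((t + 1) ^ (P + 2)) := by
  filter_upwards [eventually_mul_pow_le P C, eventually_ge_atTop (max n₀ 1)] with t ht ht1
  have htn : n₀ ≤ t := (le_max_left _ _).trans ht1
  have ht1 : 1 ≤ t := (le_max_right _ _).trans ht1
  have htp : t ≤ t ^ (P + 2) := Nat.le_self_pow (by omega) t
  have hb : (1 : ℝ) ≤ 1 + 1 / ((t : ℝ) + 1) ^ P := by
    have : 0 < 1 / ((t : ℝ) + 1) ^ P := by positivity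
    linarith
  obtain ⟨k, hk⟩ := Nat.exists_eq_add_of_le
    (Nat.pow_le_pow_left (Nat.le_succ t) (P + 2))
  rw [Nat.succ_eq_add_one] at hk
  have hk1 : t ^ (P + 1) ≤ k := by
    have h1 : (t + 1) * t ^ (P + 1) ≤ (t + 1) ^ (P + 2) := by
      calc (t + 1) * t ^ (P + 1) ≤ (t + 1) * (t + 1) ^ (P + 1) := by gcongr; omega
        _ = _ := by ring
    have h2 : (t + 1) * t ^ (P + 1) = t ^ (P + 2) + t ^ (P + 1) := by ring
    omega
  have h1 := mul_pow_le_of_step (Q := Q) (b := 1 + 1 / ((t : ℝ) + 1) ^ P) (by linarith)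
    (m := t ^ (P + 2)) (k := k) fun n hn1 hn2 => by
      refine le_trans ?_ (hstep n (by omega))
      have := hQ n (by omega)
      have h2 := rpow_one_sub_le (t := t + 1) hP (by omega : 1 ≤ n) (by omega)
      have h3 : 0 < (n : ℝ) ^ (1 - ε) := by
        have : (0 : ℝ) < n := by exact_mod_cast (by omega : 0 < n)
        positivity
      push_cast at h2
      gcongr
  rw [hk]
  refine le_trans ?_ h1
  have hQ0 := hQ (t ^ (P + 2)) (by omega)
  rw [mul_comm]
  gcongr
  exact ht.trans (pow_le_pow_right₀ hb hk1)

theorem eventually_one_le_of_growth {R : ℕ → ℝ} {T : ℕ} (h0 : 0 < R T)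
    (h : ∀ t, T ≤ t → R t * 2 ≤ R (t + 1)) : ∀ᶠ t in atTop, 1 ≤ R t := by
  have h1 : Tendsto (fun k : ℕ => R T * 2 ^ k) atTop atTop :=
    (tendsto_pow_atTop_atTop_of_one_lt one_lt_two).const_mul_atTop h0
  obtain ⟨K, hK⟩ := eventually_atTop.mp (h1.eventually_ge_atTop 1)
  filter_upwards [eventually_ge_atTop (T + K)] with t ht
  obtain ⟨k, rfl⟩ := Nat.exists_eq_add_of_le ((Nat.le_add_right T K).trans ht)
  exact (hK k (by omega)).trans (mul_pow_le_of_step zero_le_two fun n hn _ => h n hn)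

/-- The grid `j` is given by the largest power of two not exceeding `|q n|` at the start
`n = (j + 2) ^ (P + 2)` of window `j + 2`; growth across window `j + 1` makes it fine enough for
window `j`. -/
theorem exists_gridSieve {ε : ℝ} {P : ℕ} (hP : 2 / ((P : ℝ) + 2) ≤ ε) {q : ℕ → ℝ} {n₀ : ℕ}
    (hq : ∀ n, n₀ ≤ n → 0 < |q n|)
    (hstep : ∀ n, n₀ ≤ n → |q n| * (1 + 1 / (n : ℝ) ^ (1 - ε)) ≤ |q (n + 1)|)
    {c : ℝ} (hc : 0 < c) (hc' : c * 3 ^ (P + 2) ≤ 1 / 432) :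
    ∀ᶠ s : ℕ in atTop, ∃ S : GridSieve s, S.q = q ∧ (S.r = fun n : ℕ => c / (n : ℝ)) ∧
      S.W = fun j => Finset.Ico (j ^ (P + 2)) ((j + 1) ^ (P + 2)) := by
  have hself : ∀ t : ℕ, t ≤ t ^ (P + 2) := Nat.le_self_pow (by omega)
  have hmono : ∀ m n, n₀ ≤ m → m ≤ n → |q m| ≤ |q n| := by
    intro m n hm hmn
    induction n, hmn using Nat.le_induction with
    | base => exact le_rfl
    | succ n hn ih =>
      refine ih.trans (le_trans ?_ (hstep n (hm.trans hn)))
      have h1 : 0 ≤ 1 / (n : ℝ) ^ (1 - ε) := by positivity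
      nlinarith [abs_nonneg (q n)]
  have hgrow := eventually_window_growth hP (Q := fun n => |q n|) hq hstep (2 / c)
  have hone : ∀ᶠ t : ℕ in atTop, 1 ≤ |q (t ^ (P + 2))| := by
    obtain ⟨T, hT⟩ := eventually_atTop.mp
      (eventually_window_growth hP (Q := fun n => |q n|) hq hstep 2)
    refine eventually_one_le_of_growth (R := fun t => |q (t ^ (P + 2))|) (T := max T (n₀ + 1))
      (hq _ ?_) fun t ht => ?_
    · exact le_trans (le_trans (by omega) (le_max_right T (n₀ + 1))) (hself _)
    · have ht' : T ≤ t ∧ n₀ + 1 ≤ t := by simpa using ht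
      refine le_trans ?_ (hT t ht'.1)
      have h1 : (1 : ℝ) ≤ (t : ℝ) ^ (P + 2) :=
        one_le_pow₀ (by exact_mod_cast (by omega : 1 ≤ t))
      nlinarith [abs_nonneg (q (t ^ (P + 2)))]
  obtain ⟨s₀, hs₀⟩ := eventually_atTop.mp (hgrow.and hone)
  filter_upwards [eventually_ge_atTop (max s₀ (n₀ + 2))] with s hs
  have hs' : s₀ ≤ s ∧ n₀ + 2 ≤ s := by simpa using hs
  obtain ⟨hs1, hs2⟩ := hs'
  refine ⟨{
    q := q
    r := fun n => c / n
    W := fun j => Finset.Ico (j ^ (P + 2)) ((j + 1) ^ (P + 2))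
    N := fun j => 2 ^ Nat.log 2 ⌊|q ((j + 2) ^ (P + 2))|⌋₊
    two_le := by omega
    r_nonneg := fun n => by positivity
    N_pos := fun j => by positivity
    dvd := fun i j hi hij => ?_
    fine := fun j hj n hn => ?_
    coarse := fun j hj n hn => ?_
    sum_le := fun j hj => ?_ }, rfl, rfl, rfl⟩
  · refine pow_dvd_pow 2 (Nat.log_mono_right (Nat.floor_le_floor (hmono _ _ ?_ ?_)))
    · exact le_trans (by omega) (hself _)
    · gcongr
  · rw [Finset.mem_Ico] at hn
    have hjs := hself j
    have hn0 : (0 : ℝ) < n := by exact_mod_cast (by omega : 0 < n)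
    have h1 := (hs₀ (j + 1) (by omega)).1
    have h2 : |q n| ≤ |q ((j + 1) ^ (P + 2))| := hmono _ _ (by omega) hn.2.le
    have h3 : |q ((j + 2) ^ (P + 2))| <
        2 * (2 : ℝ) ^ Nat.log 2 ⌊|q ((j + 2) ^ (P + 2))|⌋₊ := by
      have h4 := Nat.lt_floor_add_one |q ((j + 2) ^ (P + 2))|
      have h5 := Nat.lt_pow_succ_log_self one_lt_two ⌊|q ((j + 2) ^ (P + 2))|⌋₊
      refine h4.trans_le ?_
      rw [← pow_succ']
      exact_mod_cast h5
    have h6 : (n : ℝ) ≤ ((j + 1 : ℕ) : ℝ) ^ (P + 2) := by exact_mod_cast hn.2.le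
    rw [div_mul_eq_mul_div, le_div_iff₀ hn0]
    have h7 : |q n| * n ≤ |q ((j + 1) ^ (P + 2))| * ((j + 1 : ℕ) : ℝ) ^ (P + 2) := by gcongr
    rw [mul_assoc, div_mul_eq_mul_div, div_le_iff₀ hc] at h1
    push_cast
    rw [show j + 1 + 1 = j + 2 from rfl] at h1
    nlinarith
  · rw [Finset.mem_Ico] at hn
    have h1 := (hs₀ (j + 2) (by omega)).2
    have hjs := hself (j + 2)
    have h2 := Nat.pow_log_le_self 2 (Nat.floor_pos.mpr h1).ne'
    calc ((2 ^ Nat.log 2 ⌊|q ((j + 2) ^ (P + 2))|⌋₊ : ℕ) : ℝ)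
        ≤ ⌊|q ((j + 2) ^ (P + 2))|⌋₊ := by exact_mod_cast h2
      _ ≤ |q ((j + 2) ^ (P + 2))| := Nat.floor_le (abs_nonneg _)
      _ ≤ |q n| := hmono _ _ (by omega) hn.1
  · have hj0 : (0 : ℝ) < j := by exact_mod_cast (by omega : 0 < j)
    have h1 := sum_one_div_le (P + 1) (by omega : 0 < j)
    calc ∑ n ∈ Finset.Ico (j ^ (P + 2)) ((j + 1) ^ (P + 2)), c / (n : ℝ)
        = c * ∑ n ∈ Finset.Ico (j ^ (P + 2)) ((j + 1) ^ (P + 2)), 1 / (n : ℝ) := by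
          rw [Finset.mul_sum]
          simp only [mul_one_div]
      _ ≤ c * (3 ^ (P + 2) / j) := by gcongr
      _ = c * 3 ^ (P + 2) / j := by ring
      _ ≤ 1 / 432 / j := by gcongr
      _ = 1 / (432 * j) := by rw [div_div]

/-! ### From small exceptional sets to almost every point -/

/-- The exceptional set of a sieve started at `s` is bounded by the tail from `s` on of a convergent
series, and the exceptional set for the union over all starts lies in each of them. -/
theorem ae_exists_of_eventually_gridSieve {q r : ℕ → ℝ} {W : ℕ → Finset ℕ}
    (h : ∀ᶠ s : ℕ in atTop, ∃ S : GridSieve s, S.q = q ∧ S.r = r ∧ S.W = W) :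
    ∀ᵐ x ∂(volume.restrict (Ico (0 : ℝ) 1)), ∃ s, ∃ δ ∈ Icc (0 : ℝ) 1,
      ∀ j, s ≤ j → ∀ n ∈ W j, r n ≤ distInt (q n * x - δ) := by
  rw [ae_restrict_iff' measurableSet_Ico, ae_iff]
  have hsum : ∑' k : ℕ, ENNReal.ofReal (1 / (k : ℝ) ^ 2) ≠ ⊤ :=
    (Real.summable_one_div_nat_pow.mpr one_lt_two).tsum_ofReal_ne_top
  refine le_antisymm (ge_of_tendsto (ENNReal.tendsto_sum_nat_add _ hsum) ?_) zero_le
  filter_upwards [h] with s hs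
  obtain ⟨S, rfl, rfl, rfl⟩ := hs
  refine le_trans (measure_mono fun x hx => ?_) S.volume_bad_le
  simp only [mem_ofPred_eq, Classical.not_imp] at hx
  exact ⟨hx.1, fun hex => hx.2 ⟨s, hex⟩⟩

theorem exists_pow_le_lt {p s n : ℕ} (hp : p ≠ 0) (h : s ^ p ≤ n) :
    ∃ j, s ≤ j ∧ j ^ p ≤ n ∧ n < (j + 1) ^ p := by
  refine ⟨Nat.findGreatest (fun j => j ^ p ≤ n) n, ?_, ?_, ?_⟩
  · exact Nat.le_findGreatest ((Nat.le_self_pow hp s).trans h) h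
  · exact Nat.findGreatest_spec (P := fun j => j ^ p ≤ n) ((Nat.le_self_pow hp s).trans h) h
  · by_contra! h'
    have := Nat.le_findGreatest (P := fun j => j ^ p ≤ n) ((Nat.le_self_pow hp _).trans h') h'
    omega

theorem theorem2 (ε : ℝ) (hε : 0 < ε) :
    ∃ cε : ℝ, 0 < cε ∧
      ∀ q : ℕ → ℝ,
        (∀ᶠ n : ℕ in Filter.atTop, q (n + 1) / q n > 1 + 1 / (n : ℝ) ^ (1 - ε)) →
        ∀ c : ℝ, 0 < c → c ≤ cε →
          ∀ᵐ x ∂(MeasureTheory.volume.restrict (Set.Ico (0 : ℝ) 1)),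
            ∃ δ₀ ∈ Set.Ico (0 : ℝ) 1,
              {n : ℕ | 1 ≤ n ∧ distInt (q n * x - δ₀) < c / (n : ℝ)}.Finite := by
  obtain ⟨P, hP⟩ := exists_nat_ge (2 / ε)
  have hP' : 2 / ((P : ℝ) + 2) ≤ ε := by
    rw [div_le_iff₀ hε] at hP
    rw [div_le_iff₀ (by positivity)]
    linarith
  -- Shrinking `c` only shrinks the arcs, so a `δ₀` found for the largest constant `b` will do.
  set b : ℝ := 1 / 432 / 3 ^ (P + 2) with hb_def
  have hb : 0 < b := by positivity
  refine ⟨b, hb, fun q hq c _ hcb => ?_⟩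
  obtain ⟨n₀, hn₀⟩ := eventually_atTop.mp hq
  have hpos : ∀ n, n₀ ≤ n → 0 < |q n| := by
    intro n hn
    -- A zero denominator would make the quotient `0`, against the gap condition.
    refine abs_pos.mpr fun h0 => ?_
    have h1 := hn₀ n hn
    have h2 : 0 ≤ 1 / (n : ℝ) ^ (1 - ε) := by positivity
    rw [h0, div_zero] at h1
    linarith
  have hstep : ∀ n, n₀ ≤ n → |q n| * (1 + 1 / (n : ℝ) ^ (1 - ε)) ≤ |q (n + 1)| := by
    intro n hn
    have h1 := (hn₀ n hn).le.trans (le_abs_self _)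
    rwa [abs_div, le_div_iff₀ (hpos n hn), mul_comm] at h1
  filter_upwards [ae_exists_of_eventually_gridSieve
    (exists_gridSieve hP' hpos hstep hb (by rw [hb_def, div_mul_cancel₀ _ (by positivity)]))]
    with x hx
  obtain ⟨s, δ, hδ, h⟩ := hx
  have hfin : {n : ℕ | 1 ≤ n ∧ distInt (q n * x - δ) < c / (n : ℝ)}.Finite := by
    refine (finite_lt_nat (s ^ (P + 2))).subset fun n hn => ?_
    by_contra hns
    obtain ⟨j, hj, h1, h2⟩ := exists_pow_le_lt (by omega : P + 2 ≠ 0) (not_lt.mp hns)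
    have h3 := h j hj n (Finset.mem_Ico.mpr ⟨h1, h2⟩)
    have h4 : c / (n : ℝ) ≤ b / n := by gcongr
    linarith [hn.2]
  -- Compactness was used on `[0, 1]`; the endpoint `1` is equivalent to `0`.
  rcases hδ.2.eq_or_lt with rfl | hδ1
  · refine ⟨0, ⟨le_rfl, one_pos⟩, ?_⟩
    simpa only [distInt_sub_one, sub_zero] using hfin
  · exact ⟨δ, ⟨hδ.1, hδ1⟩, hfin⟩
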